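/- Let $R$ be a commutative ring and let $(X,\check X,\Phi,\check\Phi,\Pi,\check\Pi)$ be a reduced based root datum: $X,\check X$ are free abelian groups of finite rank with a perfect pairing $\langle\cdot,\cdot\rangle:X\times\check X\to\mathbb Z$, $\Phi\subset X$ and $\check\Phi\subset\check X$ are the finite sets of roots and coroots, and $\Pi,\check\Pi$ are the simple roots and coroots. Let $\Phi^+$ be the set of positive roots, let $W_0\subset GL(\check X)$ be the finite Weyl group, generated by the reflections $x\mapsto x-\langle\alpha,x\rangle\check\alpha$ $(\alpha\in\Phi)$, let $\check X^+=\{x\in\check X:\langle\alpha,x\rangle\ge 0\text{ for all }\alpha\in\Phi^+\}$ be the monoid of dominant coweights, and let $\ell(x)=\sum_{\alpha\in\Phi^+}|\langle\alpha,x\rangle|$ be the length function on $\check X$. Put $$\mathcal C(\check X)=\{(x,k)\in\check X\oplus\mathbb Z: k\ge\ell(x)\},$$ a monoid on which $W_0$ acts by $w(x,k)=(wx,k)$. Regard its semigroup algebra $R[\mathcal C(\check X)]$ as an $R[q]$-algebra via $q\mapsto e^{(0,1)}$. Then the following hold. 1. There is an isomorphism of $R$-algebras $$R[\mathcal C(\check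 X)]\cong \mathrm{Rees}\,R[\check X]=\bigoplus_{i\ge 0}t^iF^iR[\check X],\qquad e^{(x,k)}\mapsto t^ke^x,$$ where $F^iR[\check X]$ is the $R$-span of the $e^x$ with $\ell(x)\le i$. 2. There is an isomorphism of $R[q]$-algebras $$\varphi: R[\mathcal C(\check X)]^{W_0}\;\cong\;R[q][\check X^+].$$ 3. The isomorphism $\varphi$ in 2 can be chosen so that setting $q=1$ in it gives an isomorphism of $R$-algebras $\psi:R[\check X]^{W_0}\cong R[\check X^+]$. That is, $\psi$ is compatible with $\varphi$ under the maps $R[\mathcal C(\check X)]^{W_0}\to R[\check X]^{W_0}$, $e^{(x,k)}\mapsto e^x$, and $R[q][\check X^+]\to R[\check X^+]$, $q\mapsto 1$. -/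

import Mathlib

noncomputable section

namespace BasedRootDatum

variable {ι X Y : Type*} [AddCommGroup X] [AddCommGroup Y] {P : RootDatum ι X Y}

/-- The finite Weyl group `W₀`: the subgroup of `GL(Y)` generated by the reflections
`y ↦ y - ⟨α, y⟩ α^∨`, where `Y` is the coweight lattice. -/
def weyl (P : RootDatum ι X Y) : Subgroup (Y ≃ₗ[ℤ] Y) :=
  Subgroup.closure (Set.range P.coreflection)

section Length

variable [Fintype ι]

open Classical in
/-- The length function `ℓ(y) = ∑_{α > 0} |⟨α, y⟩|` on the coweight lattice. -/
def len (b : P.Base) (y : Y) : ℤ :=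
  ∑ i : ι with b.IsPos i, |P.toLinearMap (P.root i) y|

theorem len_nonneg (b : P.Base) (y : Y) : 0 ≤ len b y :=
  Finset.sum_nonneg fun _ _ => abs_nonneg _

theorem len_zero (b : P.Base) : len b (0 : Y) = 0 := by
  simp [len]

theorem len_add_le (b : P.Base) (y z : Y) : len b (y + z) ≤ len b y + len b z := by
  unfold len
  rw [← Finset.sum_add_distrib]
  refine Finset.sum_le_sum fun i _ => ?_
  rw [map_add]
  exact abs_add_le _ _

theorem two_mul_len (b : P.Base) (y : Y) :
    2 * len b y = ∑ i : ι, |P.toLinearMap (P.root i) y| := by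
  classical
  let := P.indexNeg
  have key : ∑ i : ι with ¬ b.IsPos i, |P.toLinearMap (P.root i) y| = len b y := by
    unfold len
    refine Finset.sum_bij' (fun i _ => -i) (fun i _ => -i) ?_ ?_ ?_ ?_ ?_
    · intro i hi
      simp only [Finset.mem_filter, Finset.mem_univ, true_and] at hi ⊢
      exact (RootPairing.Base.IsPos.or_neg b i).resolve_left hi
    · intro i hi
      simp only [Finset.mem_filter, Finset.mem_univ, true_and] at hi ⊢
      rw [RootPairing.Base.IsPos.neg_iff_not]
      exact not_not.mpr hi
    · intro i _
      exact neg_neg i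
    · intro i _
      exact neg_neg i
    · intro i _
      have : P.root (-i) = - P.root i := by
        simp [P.root_reflectionPerm, P.reflection_apply_self]
      rw [this]
      simp
  have h := Finset.sum_filter_add_sum_filter_not (Finset.univ : Finset ι)
    (fun i => b.IsPos i) (fun i => |P.toLinearMap (P.root i) y|)
  rw [key] at h
  have h' : (∑ i : ι with b.IsPos i, |P.toLinearMap (P.root i) y|) = len b y := rfl
  rw [h'] at h
  linarith

theorem len_coreflection (b : P.Base) (i : ι) (y : Y) :
    len b (P.coreflection i y) = len b y := by
  have h : ∑ j : ι, |P.toLinearMap (P.root j) (P.coreflection i y)|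
      = ∑ j : ι, |P.toLinearMap (P.root j) y| := by
    refine Fintype.sum_equiv (P.reflectionPerm i) _ _ fun j => ?_
    rw [← P.reflectionPerm_root i j]
    simp only [P.coreflection_apply, map_sub, map_smul, LinearMap.sub_apply,
      LinearMap.smul_apply, smul_eq_mul]
    congr 1
    have : P.root' i y = P.toLinearMap (P.root i) y := rfl
    rw [this]
    ring
  have h1 := two_mul_len b (P.coreflection i y)
  have h2 := two_mul_len b y
  linarith

theorem len_weyl (b : P.Base) (w : weyl P) (y : Y) :
    len b ((w : Y ≃ₗ[ℤ] Y) y) = len b y := by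
  obtain ⟨w, hw⟩ := w
  change len b (w y) = len b y
  unfold weyl at hw
  induction hw using Subgroup.closure_induction generalizing y with
  | mem x hx =>
    obtain ⟨i, rfl⟩ := hx
    exact len_coreflection b i y
  | one => rfl
  | mul x z _ _ hx hz => exact (hx (z y)).trans (hz y)
  | inv x _ hx =>
    have h := hx (x⁻¹ y)
    rw [← h]
    congr 1
    exact LinearEquiv.apply_symm_apply x y

end Length

/-- The monoid `Y⁺` of dominant coweights. -/
def dominant (b : P.Base) : AddSubmonoid Y where
  carrier := {y | ∀ i, b.IsPos i → 0 ≤ P.toLinearMap (P.root i) y}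
  zero_mem' := by
    intro i _
    simp
  add_mem' := by
    intro y z hy hz i hi
    rw [map_add]
    exact add_nonneg (hy i hi) (hz i hi)

section Cone

variable [Fintype ι]

/-- The conic monoid `C(Y) = {(y, k) ∈ Y ⊕ ℤ : k ≥ ℓ(y)}`. -/
def cone (b : P.Base) : AddSubmonoid (Y × ℤ) where
  carrier := {c | len b c.1 ≤ c.2}
  zero_mem' := by simp [len_zero]
  add_mem' := by
    intro c d hc hd
    exact (len_add_le b c.1 d.1).trans (add_le_add hc hd)

/-- The action of an element of `W₀` on `C(Y)`, given by `(y, k) ↦ (w y, k)`. -/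
def coneAct (b : P.Base) (w : weyl P) : cone b ≃+ cone b where
  toFun c := ⟨((w : Y ≃ₗ[ℤ] Y) c.1.1, c.1.2), (len_weyl b w c.1.1).trans_le c.2⟩
  invFun c := ⟨(((w⁻¹ : weyl P) : Y ≃ₗ[ℤ] Y) c.1.1, c.1.2),
    (len_weyl b w⁻¹ c.1.1).trans_le c.2⟩
  left_inv c := Subtype.ext (Prod.ext (LinearEquiv.symm_apply_apply (w : Y ≃ₗ[ℤ] Y) c.1.1) rfl)
  right_inv c := Subtype.ext (Prod.ext (LinearEquiv.apply_symm_apply (w : Y ≃ₗ[ℤ] Y) c.1.1) rfl)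
  map_add' c d := Subtype.ext (Prod.ext (map_add (w : Y ≃ₗ[ℤ] Y) c.1.1 d.1.1) rfl)

/-- The element `(0, 1)` of `C(Y)`. -/
def coneUnit (b : P.Base) : cone b :=
  ⟨(0, 1), (len_zero b).trans_le zero_le_one⟩

variable (R : Type*) [CommRing R]

/-- The `R[q]`-algebra structure on the semigroup algebra `R[C(Y)]`, with `q ↦ e^{(0,1)}`. -/
instance coneAlgebra (b : P.Base) :
    Algebra (Polynomial R) (AddMonoidAlgebra R (cone b)) :=
  (Polynomial.aeval (R := R) (AddMonoidAlgebra.single (coneUnit b) (1 : R))).toRingHom.toAlgebra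

/-- The algebra of invariants `R[C(Y)]^{W₀}`, as an `R[q]`-subalgebra of `R[C(Y)]`. -/
def coneInvariants (b : P.Base) :
    Subalgebra (Polynomial R) (AddMonoidAlgebra R (cone b)) where
  carrier := {f | ∀ w : weyl P, AddMonoidAlgebra.domCongr R R (coneAct b w) f = f}
  mul_mem' := by
    intro f g hf hg w
    rw [map_mul, hf w, hg w]
  add_mem' := by
    intro f g hf hg w
    rw [map_add, hf w, hg w]
  algebraMap_mem' := by
    intro p w
    change AddMonoidAlgebra.domCongr R R (coneAct b w)
      (Polynomial.aeval (AddMonoidAlgebra.single (coneUnit b) (1 : R)) p)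
        = Polynomial.aeval (AddMonoidAlgebra.single (coneUnit b) (1 : R)) p
    have hu : coneAct b w (coneUnit b) = coneUnit b :=
      Subtype.ext (Prod.ext (map_zero (w : Y ≃ₗ[ℤ] Y)) rfl)
    rw [← Polynomial.aeval_algHom_apply, AddMonoidAlgebra.domCongr_single, hu]

/-- The algebra of invariants `R[Y]^{W₀}`, as an `R`-subalgebra of the group algebra `R[Y]`. -/
def latticeInvariants (P : RootDatum ι X Y) : Subalgebra R (AddMonoidAlgebra R Y) where
  carrier := {f | ∀ w : weyl P,
    AddMonoidAlgebra.domCongr R R (w : Y ≃ₗ[ℤ] Y).toAddEquiv f = f}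
  mul_mem' := by
    intro f g hf hg w
    rw [map_mul, hf w, hg w]
  add_mem' := by
    intro f g hf hg w
    rw [map_add, hf w, hg w]
  algebraMap_mem' := by
    intro r w
    exact AlgEquiv.commutes _ r

/-- The specialization `q = 1` of the cone algebra: `R[C(Y)] → R[Y]`, `e^{(y,k)} ↦ e^y`. -/
def coneAtOne (b : P.Base) : AddMonoidAlgebra R (cone b) →ₐ[R] AddMonoidAlgebra R Y :=
  AddMonoidAlgebra.mapDomainAlgHom R R ((AddMonoidHom.fst Y ℤ).comp (cone b).subtype)

/-- The specialization `q = 1` of coefficients: `R[q][Y⁺] → R[Y⁺]`. -/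
def dominantAtOne (b : P.Base) :
    AddMonoidAlgebra (Polynomial R) (dominant b) →ₐ[R] AddMonoidAlgebra R (dominant b) :=
  AddMonoidAlgebra.mapAlgHom (dominant b) (Polynomial.aeval (1 : R))

/-- The length filtration: `Fⁿ R[Y]` is the `R`-span of the `e^y` with `ℓ(y) ≤ n`. -/
def lenFiltration (b : P.Base) (n : ℕ) : Submodule R (AddMonoidAlgebra R Y) :=
  Submodule.span R {f | ∃ y : Y, len b y ≤ n ∧ f = AddMonoidAlgebra.single y 1}

theorem lenFiltration_mono (b : P.Base) {m n : ℕ} (h : m ≤ n) :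
    lenFiltration R b m ≤ lenFiltration R b n := by
  refine Submodule.span_mono ?_
  rintro f ⟨y, hy, rfl⟩
  exact ⟨y, hy.trans (by exact_mod_cast h), rfl⟩

theorem lenFiltration_mul (b : P.Base) (m n : ℕ) :
    lenFiltration R b m * lenFiltration R b n ≤ lenFiltration R b (m + n) := by
  unfold lenFiltration
  rw [Submodule.span_mul_span]
  refine Submodule.span_mono ?_
  rintro f ⟨g, ⟨y, hy, rfl⟩, h, ⟨z, hz, rfl⟩, rfl⟩
  refine ⟨y + z, ?_, ?_⟩
  · push_cast
    exact (len_add_le b y z).trans (add_le_add hy hz)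
  · simp [AddMonoidAlgebra.single_mul_single]

/-- The Rees algebra `⨁ₙ tⁿ Fⁿ R[Y]` of the length filtration, as a subalgebra of `R[Y][t]`. -/
def rees (b : P.Base) : Subalgebra R (Polynomial (AddMonoidAlgebra R Y)) where
  carrier := {f | ∀ n, f.coeff n ∈ lenFiltration R b n}
  mul_mem' := by
    intro f g hf hg n
    rw [Polynomial.coeff_mul]
    refine Submodule.sum_mem _ fun ij hij => ?_
    have h := lenFiltration_mul R b ij.1 ij.2 (Submodule.mul_mem_mul (hf ij.1) (hg ij.2))
    rwa [Finset.HasAntidiagonal.mem_antidiagonal.mp hij] at h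
  add_mem' := by
    intro f g hf hg n
    rw [Polynomial.coeff_add]
    exact Submodule.add_mem _ (hf n) (hg n)
  algebraMap_mem' := by
    intro r n
    rw [Polynomial.algebraMap_apply, Polynomial.coeff_C]
    split_ifs with h
    · rw [Algebra.algebraMap_eq_smul_one]
      refine Submodule.smul_mem _ _ (Submodule.subset_span ⟨0, ?_, rfl⟩)
      rw [len_zero]
      exact Int.natCast_nonneg n
    · exact Submodule.zero_mem _

end Cone

end BasedRootDatum

end

/-! ### Words in the simple reflections and the Weyl group -/

noncomputable section

namespace BasedRootDatum

variable {ι X Y : Type*} [AddCommGroup X] [AddCommGroup Y] {P : RootDatum ι X Y}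

/-! Both invariant algebras have a basis indexed by the dominant coweights and multiplicative in the
index; the isomorphisms send it to the monomials `e^y`. Orbit sums form a basis but are not
multiplicative. If the fundamental coweights `ω_i` lay in `Y`, products of their orbit sums would
do, up to a factor fixed by `W₀`. In general only multiples `η_i = d ω_i` lie in `Y`. Still, the
orbit of `ω_i` lies in `ω_i + Y`, so `f_i = e^{-ω_i} · (orbit sum of ω_i)` makes sense in `R[Y]`,
and so does `M_y = e^y ∏ f_i^{⟨α_i, y⟩}`. Invariance of `M_y` is checked after the injective
equivariant substitution `e^z ↦ e^{dz}` (`exists_dominant_family`).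

Let `ht` be the pairing with the sum of the positive roots. Then `ht ≤ ℓ`, with equality exactly on
dominant coweights, and `ℓ` is invariant under `W₀`. Hence `M_y` is `e^y` plus terms of smaller
`ht`. An invariant is determined by its coefficients at dominant coweights, since every orbit
contains one, so unitriangularity makes the `M_y` a basis of `R[Y]^{W₀}`.

In the Rees picture of the cone algebra, the terms of `M_y` have length at most `ℓ(y)`, so `t^{ℓ(y)}
M_y` lies in the cone algebra. It is multiplicative in `y` because `ℓ` is additive on dominant
coweights, and the `q^j t^{ℓ(y)} M_y` form an `R`-basis of the invariants. Setting `t = 1` gives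
back `M_y`. -/

theorem coreflection_apply' (P : RootDatum ι X Y) (i : ι) (y : Y) :
    P.coreflection i y = y - P.toLinearMap (P.root i) y • P.coroot i := rfl

theorem pairing_reflectionPerm_coreflection (P : RootDatum ι X Y) (i j : ι) (y : Y) :
    P.toLinearMap (P.root (P.reflectionPerm i j)) (P.coreflection i y)
      = P.toLinearMap (P.root j) y := by
  simp only [← P.reflectionPerm_root i j, coreflection_apply', map_sub, map_smul,
    LinearMap.sub_apply, LinearMap.smul_apply, smul_eq_mul, P.root_coroot_two]
  ring

theorem pairing_coreflection (P : RootDatum ι X Y) (i j : ι) (y : Y) :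
    P.toLinearMap (P.root j) (P.coreflection i y)
      = P.toLinearMap (P.root (P.reflectionPerm i j)) y := by
  have := pairing_reflectionPerm_coreflection P i (P.reflectionPerm i j) y
  rwa [P.reflectionPerm_self] at this

theorem coreflection_reflectionPerm (P : RootDatum ι X Y) (i j : ι) :
    P.coreflection (P.reflectionPerm i j)
      = P.coreflection i * P.coreflection j * P.coreflection i := by
  have key : ∀ y, P.coreflection (P.reflectionPerm i j) (P.coreflection i y)
      = P.coreflection i (P.coreflection j y) := by
    intro y
    rw [coreflection_apply' P (P.reflectionPerm i j), pairing_reflectionPerm_coreflection,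
      coreflection_apply' P j, map_sub, map_smul]
    congr 2
    exact (P.reflectionPerm_coroot i j).symm
  ext y
  simpa using key (P.coreflection i y)

/-- An element killed by all roots lies in the kernel of the coroot form, which meets the coroot
span trivially. -/
theorem eq_zero_of_mem_corootSpan [Finite ι] {y : Y} (hy : y ∈ P.corootSpan ℤ)
    (h : ∀ i, P.toLinearMap (P.root i) y = 0) : y = 0 := by
  have := Fintype.ofFinite ι
  refine Submodule.disjoint_def.mp P.disjoint_corootSpan_ker_corootForm y hy ?_
  rw [LinearMap.mem_ker]
  ext z
  have h' : ∀ i, P.root' i y = 0 := h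
  simp [RootPairing.CorootForm, RootPairing.rootForm_apply_apply, h']

theorem coreflection_sub_mem_corootSpan (P : RootDatum ι X Y) (i : ι) (y : Y) :
    P.coreflection i y - y ∈ P.corootSpan ℤ := by
  rw [coreflection_apply', sub_sub_cancel_left]
  exact neg_mem (Submodule.smul_mem _ _ (Submodule.subset_span ⟨i, rfl⟩))

theorem coreflection_mul_self (P : RootDatum ι X Y) (i : ι) :
    P.coreflection i * P.coreflection i = 1 := by
  ext y
  simp

/-- Every root arises from simple roots by simple reflections, and reflecting a root conjugates its
reflection. -/
theorem coreflection_mem_closure_support [Finite ι] [P.IsReduced] (b : P.Base) (i : ι) :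
    P.coreflection i ∈ Subgroup.closure (P.coreflection '' b.support) := by
  refine b.induction_reflect i
    (p := fun i => P.coreflection i ∈ Subgroup.closure (P.coreflection '' b.support)) ?_ ?_ ?_
  · intro i hi
    rw [coreflection_reflectionPerm]
    exact mul_mem (mul_mem hi hi) hi
  · intro i hi
    exact Subgroup.subset_closure ⟨i, hi, rfl⟩
  · intro i j hi hj
    have hj' : P.coreflection j ∈ Subgroup.closure (P.coreflection '' b.support) :=
      Subgroup.subset_closure ⟨j, hj, rfl⟩
    rw [coreflection_reflectionPerm]
    exact mul_mem (mul_mem hj' hi) hj'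

/-- The Weyl group element given by a word in the simple reflections. -/
def word (b : P.Base) (L : List b.support) : Y ≃ₗ[ℤ] Y :=
  (L.map fun i => P.coreflection i).prod

/-- The action on root indices of a word in the simple reflections. -/
def wordPerm (b : P.Base) (L : List b.support) : Equiv.Perm ι :=
  (L.map fun i => P.reflectionPerm i).prod

@[simp] theorem word_nil (b : P.Base) : word b [] = 1 := rfl

@[simp] theorem word_cons (b : P.Base) (i : b.support) (L : List b.support) :
    word b (i :: L) = P.coreflection i * word b L := by
  simp [word]

theorem word_append (b : P.Base) (L L' : List b.support) :
    word b (L ++ L') = word b L * word b L' := by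
  simp [word]

theorem word_mul_word_reverse (b : P.Base) (L : List b.support) :
    word b L * word b L.reverse = 1 := by
  induction L with
  | nil => rfl
  | cons i L ih =>
    rw [List.reverse_cons, word_append, word_cons, word_cons, word_nil, mul_one, mul_assoc,
      ← mul_assoc (word b L), ih, one_mul, coreflection_mul_self]

@[simp] theorem wordPerm_nil (b : P.Base) : wordPerm b [] = 1 := rfl

@[simp] theorem wordPerm_cons (b : P.Base) (i : b.support) (L : List b.support) :
    wordPerm b (i :: L) = P.reflectionPerm i * wordPerm b L := by
  simp [wordPerm]

theorem pairing_wordPerm_word (b : P.Base) (L : List b.support) (j : ι) (y : Y) :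
    P.toLinearMap (P.root (wordPerm b L j)) (word b L y) = P.toLinearMap (P.root j) y := by
  induction L with
  | nil => rfl
  | cons i L ih => rw [wordPerm_cons, word_cons, Equiv.Perm.mul_apply, LinearEquiv.mul_apply,
      pairing_reflectionPerm_coreflection, ih]

theorem coreflection_wordPerm (b : P.Base) (L : List b.support) (j : ι) :
    P.coreflection (wordPerm b L j) * word b L = word b L * P.coreflection j := by
  induction L with
  | nil => simp
  | cons i L ih =>
    rw [wordPerm_cons, word_cons, Equiv.Perm.mul_apply, coreflection_reflectionPerm, mul_assoc,
      ← mul_assoc (P.coreflection i) (P.coreflection i), coreflection_mul_self, one_mul, mul_assoc,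
      ih, mul_assoc]

theorem exists_word_eq_of_mem_weyl [Finite ι] [P.IsReduced] (b : P.Base) {w : Y ≃ₗ[ℤ] Y} (hw : w ∈ weyl P) :
    ∃ L : List b.support, w = word b L := by
  have hle : weyl P ≤ Subgroup.closure (P.coreflection '' b.support) := by
    rw [weyl, Subgroup.closure_le]
    rintro _ ⟨i, rfl⟩
    exact coreflection_mem_closure_support b i
  replace hw := hle hw
  induction hw using Subgroup.closure_induction with
  | mem x hx =>
    obtain ⟨i, hi, rfl⟩ := hx
    exact ⟨[⟨i, hi⟩], by simp⟩
  | one => exact ⟨[], rfl⟩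
  | mul x y hx hy ihx ihy =>
    obtain ⟨L, rfl⟩ := ihx
    obtain ⟨L', rfl⟩ := ihy
    exact ⟨L ++ L', (word_append b L L').symm⟩
  | inv x hx ihx =>
    obtain ⟨L, rfl⟩ := ihx
    exact ⟨L.reverse, inv_eq_of_mul_eq_one_right (word_mul_word_reverse b L)⟩

/-! ### Exchange and uniqueness of dominant representatives -/

theorem not_isPos_reflectionPerm_iff [Finite ι] [P.IsReduced] {b : P.Base} {i j : ι}
    (hi : i ∈ b.support) (hj : b.IsPos j) : ¬ b.IsPos (P.reflectionPerm i j) ↔ j = i := by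
  refine ⟨fun h => ?_, ?_⟩
  · by_contra hne
    exact h (hj.reflectionPerm hi hne)
  · rintro rfl
    have := RootPairing.Base.IsPos.neg_iff_not b j
    exact fun h => this.mp h hj

/-- Applying the letters from the right, some letter `s_i` first turns the image of `α_j` negative.
That image is then `α_i` itself, so for the suffix `T` already applied `T s_j = s_i T`, and the two
copies of `s_i` cancel. -/
theorem exchange [Finite ι] [P.IsReduced] (b : P.Base) (L : List b.support) (j : b.support)
    (h : ¬ b.IsPos (wordPerm b L j)) :
    ∃ L' : List b.support, L'.length + 1 = L.length ∧
      word b L * P.coreflection j = word b L' := by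
  induction L with
  | nil => exact absurd (b.isPos_of_mem_support j.2) h
  | cons i L ih =>
    by_cases hT : b.IsPos (wordPerm b L j)
    · rw [wordPerm_cons, Equiv.Perm.mul_apply, not_isPos_reflectionPerm_iff i.2 hT] at h
      refine ⟨L, rfl, ?_⟩
      rw [word_cons, mul_assoc, ← coreflection_wordPerm, h, ← mul_assoc, coreflection_mul_self,
        one_mul]
    · obtain ⟨L', hL', h'⟩ := ih hT
      refine ⟨i :: L', by simpa using hL', ?_⟩
      rw [word_cons, word_cons, mul_assoc, h']

/-- Induction on word length, with last letter `s_j` and remaining word `T`. If `T α_j` is positive,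
dominance at both ends forces `⟨α_j, y⟩ = 0`, so `s_j` can be dropped; otherwise exchange shortens
the word. -/
theorem word_apply_eq_of_dominant [Finite ι] [P.IsReduced] (b : P.Base) {y : Y}
    (hy : y ∈ dominant b) (L : List b.support) (hL : word b L y ∈ dominant b) :
    word b L y = y := by
  induction hn : L.length using Nat.strong_induction_on generalizing L with
  | _ n ih =>
  rcases List.eq_nil_or_concat L with rfl | ⟨T, j, rfl⟩
  · rfl
  rw [List.concat_eq_append] at *
  have hw : word b (T ++ [j]) = word b T * P.coreflection j := by simp [word_append]
  rw [hw] at hL ⊢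
  by_cases hT : b.IsPos (wordPerm b T j)
  · have h1 := hL _ hT
    rw [LinearEquiv.mul_apply, pairing_wordPerm_word] at h1
    have h2 := hy _ (b.isPos_of_mem_support j.2)
    have h3 : P.toLinearMap (P.root j) (P.coreflection j y) = - P.toLinearMap (P.root j) y := by
      rw [coreflection_apply', map_sub, map_smul, P.root_coroot_two, smul_eq_mul]
      ring
    have h4 : P.coreflection j y = y := by
      rw [coreflection_apply', show P.toLinearMap (P.root j) y = 0 by linarith]
      simp
    rw [LinearEquiv.mul_apply, h4] at hL ⊢
    exact ih _ (by simp [← hn]) T hL rfl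
  · obtain ⟨L', hL', h'⟩ := exchange b T j hT
    rw [h'] at hL ⊢
    exact ih _ (by simp [← hn]; lia) L' hL rfl

theorem weyl_apply_eq_of_dominant [Finite ι] [P.IsReduced] (b : P.Base) {y : Y}
    (hy : y ∈ dominant b) {w : Y ≃ₗ[ℤ] Y} (hw : w ∈ weyl P) (h : w y ∈ dominant b) : w y = y := by
  obtain ⟨L, rfl⟩ := exists_word_eq_of_mem_weyl b hw
  exact word_apply_eq_of_dominant b hy L h

theorem mem_dominant_of_support [Finite ι] {b : P.Base} {y : Y}
    (h : ∀ i ∈ b.support, 0 ≤ P.toLinearMap (P.root i) y) : y ∈ dominant b := by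
  intro i hi
  refine hi.induction_on_add h ?_
  intro i j k hk hi hj
  rw [hk, map_add, LinearMap.add_apply]
  exact add_nonneg hi (h j hj)

theorem pairing_eq_zero_of_support [Finite ι] {b : P.Base} {y : Y}
    (h : ∀ i ∈ b.support, P.toLinearMap (P.root i) y = 0) (i : ι) :
    P.toLinearMap (P.root i) y = 0 := by
  refine b.induction_add i ?_ h ?_
  · intro i hi
    rw [← P.reflectionPerm_root, P.root_coroot_two, map_sub, map_smul, LinearMap.sub_apply,
      LinearMap.smul_apply, hi, smul_zero, sub_zero]
  · intro i j k hk hi hj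
    rw [hk, map_add, LinearMap.add_apply, hi, h j hj, add_zero]

/-! ### Height, length and orbits -/

section Height

variable [Fintype ι]

open Classical in
/-- The pairing with the sum of the positive roots. -/
def ht (b : P.Base) : Y →+ ℤ :=
  ∑ i : ι with b.IsPos i, (P.toLinearMap (P.root i)).toAddMonoidHom

open Classical in
theorem ht_apply (b : P.Base) (y : Y) :
    ht b y = ∑ i : ι with b.IsPos i, P.toLinearMap (P.root i) y := by
  simp [ht, AddMonoidHom.finsetSum_apply]

theorem ht_le_len (b : P.Base) (y : Y) : ht b y ≤ len b y := by
  rw [ht_apply]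
  exact Finset.sum_le_sum fun i _ => le_abs_self _

theorem ht_eq_len_iff (b : P.Base) (y : Y) : ht b y = len b y ↔ y ∈ dominant b := by
  rw [ht_apply, len, Finset.sum_eq_sum_iff_of_le fun i _ => le_abs_self _]
  simp [dominant, eq_comm (b := |_|)]

theorem len_add_of_dominant (b : P.Base) {y z : Y} (hy : y ∈ dominant b) (hz : z ∈ dominant b) :
    len b (y + z) = len b y + len b z := by
  rw [← (ht_eq_len_iff b y).mpr hy, ← (ht_eq_len_iff b z).mpr hz,
    ← (ht_eq_len_iff b _).mpr (add_mem hy hz), map_add]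

/-- A simple reflection permutes the positive roots other than its own. -/
theorem ht_coreflection [P.IsReduced] (b : P.Base) {j : ι} (hj : j ∈ b.support) (y : Y) :
    ht b (P.coreflection j y) = ht b y - 2 * P.toLinearMap (P.root j) y := by
  classical
  have hmem : j ∈ Finset.univ.filter fun i => b.IsPos i := by
    simpa using b.isPos_of_mem_support hj
  rw [ht_apply, ht_apply, ← Finset.add_sum_erase _ _ hmem, ← Finset.add_sum_erase _ _ hmem]
  have h1 : P.toLinearMap (P.root j) (P.coreflection j y) = - P.toLinearMap (P.root j) y := by
    rw [coreflection_apply', map_sub, map_smul, P.root_coroot_two, smul_eq_mul]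
    ring
  have h2 : ∑ i ∈ (Finset.univ.filter fun i => b.IsPos i).erase j,
      P.toLinearMap (P.root i) (P.coreflection j y)
      = ∑ i ∈ (Finset.univ.filter fun i => b.IsPos i).erase j, P.toLinearMap (P.root i) y := by
    have hmaps : ∀ i ∈ (Finset.univ.filter fun i => b.IsPos i).erase j,
        P.reflectionPerm j i ∈ (Finset.univ.filter fun i => b.IsPos i).erase j := by
      intro i hi
      simp only [Finset.mem_erase, Finset.mem_filter, Finset.mem_univ, true_and] at hi ⊢
      have hp := hi.2.reflectionPerm hj hi.1
      refine ⟨fun h => ?_, hp⟩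
      have h' := (not_isPos_reflectionPerm_iff hj hp).mpr h
      rw [P.reflectionPerm_self] at h'
      exact h' hi.2
    exact Finset.sum_nbij' (P.reflectionPerm j) (P.reflectionPerm j) hmaps hmaps
      (fun i _ => P.reflectionPerm_self j i) (fun i _ => P.reflectionPerm_self j i)
      (fun i _ => pairing_coreflection P j i y)
  rw [h1, h2]
  ring

/-- Reflecting in a simple root with negative pairing raises `ht` and keeps `ℓ`, so the nonnegative
gap `ℓ - ht` drops. -/
theorem exists_weyl_apply_mem_dominant [P.IsReduced] (b : P.Base) (y : Y) :
    ∃ w : weyl P, (w : Y ≃ₗ[ℤ] Y) y ∈ dominant b := by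
  induction hn : (len b y - ht b y).toNat using Nat.strong_induction_on generalizing y with
  | _ n ih =>
  by_cases hy : ∀ i ∈ b.support, 0 ≤ P.toLinearMap (P.root i) y
  · exact ⟨1, mem_dominant_of_support hy⟩
  · push Not at hy
    obtain ⟨j, hj, hlt⟩ := hy
    obtain ⟨w, hw⟩ := ih _ (by
      have := ht_coreflection b hj y
      have h1 := ht_le_len b (P.coreflection j y)
      rw [len_coreflection] at h1 ⊢
      lia) (P.coreflection j y) rfl
    exact ⟨w * (⟨P.coreflection j, Subgroup.subset_closure ⟨j, rfl⟩⟩ : weyl P), hw⟩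

omit [Fintype ι] in
theorem weyl_sub_mem_corootSpan (w : weyl P) (y : Y) :
    (w : Y ≃ₗ[ℤ] Y) y - y ∈ P.corootSpan ℤ := by
  obtain ⟨w, hw⟩ := w
  change w y - y ∈ _
  unfold weyl at hw
  induction hw using Subgroup.closure_induction generalizing y with
  | mem x hx =>
    obtain ⟨i, rfl⟩ := hx
    exact coreflection_sub_mem_corootSpan P i y
  | one => simp
  | mul x z _ _ hx hz => simpa using add_mem (hx (z y)) (hz y)
  | inv x _ hx =>
    have := neg_mem (hx (x⁻¹ y))
    simpa [show x (x⁻¹ y) = y from LinearEquiv.apply_symm_apply x y] using this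

/-- Pairings with roots are bounded on the orbit because `ℓ` is constant there, and they separate
its points because the orbit lies in one coset of the coroot span. -/
theorem finite_orbit (b : P.Base) (y : Y) : (MulAction.orbit (weyl P) y).Finite := by
  let F : Y → ι → ℤ := fun z i => P.toLinearMap (P.root i) z
  refine Set.Finite.of_finite_image (f := F) ?_ ?_
  · refine (Set.Finite.pi' fun _ : ι => Set.finite_Icc (-(2 * len b y)) (2 * len b y)).subset ?_
    rintro _ ⟨_, ⟨w, rfl⟩, rfl⟩ i
    have h1 := two_mul_len b ((w : Y ≃ₗ[ℤ] Y) y)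
    have h2 := Finset.single_le_sum
      (f := fun i => |P.toLinearMap (P.root i) ((w : Y ≃ₗ[ℤ] Y) y)|)
      (fun i _ => abs_nonneg _) (Finset.mem_univ i)
    rw [← h1, len_weyl] at h2
    exact Set.mem_Icc.mpr (abs_le.mp h2)
  · rintro _ ⟨w, rfl⟩ _ ⟨w', rfl⟩ h
    have hmem := sub_mem (weyl_sub_mem_corootSpan w y) (weyl_sub_mem_corootSpan w' y)
    rw [sub_sub_sub_cancel_right] at hmem
    refine sub_eq_zero.mp (eq_zero_of_mem_corootSpan hmem fun i => ?_)
    rw [map_sub]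
    exact sub_eq_zero.mpr (congrFun h i)

open Classical in
theorem exists_scaled_fundamental_coweights (b : P.Base) :
    ∃ d : ℤ, 0 < d ∧ ∃ η : b.support → Y, ∀ i j : b.support,
      P.toLinearMap (P.root j) (η i) = if i = j then d else 0 := by
  let C : Matrix b.support b.support ℤ := fun i j => P.toLinearMap (P.root j) (P.coroot i)
  have hC : C.det ≠ 0 := by
    intro h0
    obtain ⟨v, hv, hv0⟩ := Matrix.exists_vecMul_eq_zero_iff.mpr h0
    have hy : ∑ i, v i • P.coroot i = 0 := by
      refine eq_zero_of_mem_corootSpan (P := P) ?_ (pairing_eq_zero_of_support (b := b) ?_)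
      · exact Submodule.sum_mem _ fun i _ =>
          Submodule.smul_mem _ _ (Submodule.subset_span ⟨i, rfl⟩)
      · intro j hj
        simpa [Matrix.vecMul, dotProduct, C] using congrFun hv0 ⟨j, hj⟩
    have := Fintype.linearIndependent_iff.mp b.linearIndepOn_coroot v hy
    exact hv (funext this)
  -- The adjugate inverts the Cartan matrix up to its determinant; the extra factor `C.det` makes
  -- `d` a positive square.
  refine ⟨C.det * C.det, mul_self_pos.mpr hC, fun i => C.det • ∑ k, C.adjugate i k • P.coroot k, ?_⟩
  intro i j
  have := congrFun (congrFun C.adjugate_mul i) j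
  rw [Matrix.mul_apply] at this
  simp only [map_smul, map_sum, smul_eq_mul]
  change C.det * ∑ k, C.adjugate i k * C k j = _
  rw [this, Matrix.smul_apply, Matrix.one_apply]
  split_ifs <;> simp

/-- Simple reflections move `y` by multiples of `d` and preserve `dY`. For `y = d ω_i` this replaces
the statement that the orbit of `ω_i` lies in `ω_i + Y`. -/
theorem weyl_sub_mem_smul [P.IsReduced] (b : P.Base) {d : ℤ} {y : Y}
    (hy : ∀ j ∈ b.support, d ∣ P.toLinearMap (P.root j) y) (w : weyl P) :
    ∃ z : Y, (w : Y ≃ₗ[ℤ] Y) y = y + d • z := by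
  obtain ⟨w, hw⟩ := w
  obtain ⟨L, rfl⟩ := exists_word_eq_of_mem_weyl b hw
  change ∃ z : Y, word b L y = y + d • z
  clear hw
  induction L with
  | nil => exact ⟨0, by simp⟩
  | cons i L ih =>
    obtain ⟨z, hz⟩ := ih
    obtain ⟨c, hc⟩ := hy i i.2
    refine ⟨P.coreflection i z - c • P.coroot i, ?_⟩
    rw [word_cons, LinearEquiv.mul_apply, hz, map_add, map_smul, coreflection_apply' P i y, hc,
      smul_sub, mul_smul]
    abel

theorem weyl_apply_eq_self [P.IsReduced] (b : P.Base) {y : Y}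
    (hy : ∀ j ∈ b.support, P.toLinearMap (P.root j) y = 0) (w : weyl P) :
    (w : Y ≃ₗ[ℤ] Y) y = y := by
  obtain ⟨z, hz⟩ := weyl_sub_mem_smul b (d := 0) (fun j hj => by rw [hy j hj]) w
  simpa using hz

/-- Here `ht (w y) ≤ ℓ(w y) = ℓ(y) = ht y`; equality would make `w y` dominant, hence equal to `y`.
-/
theorem ht_lt_of_mem_orbit [P.IsReduced] (b : P.Base) {y : Y} (hy : y ∈ dominant b) (w : weyl P)
    (hne : (w : Y ≃ₗ[ℤ] Y) y ≠ y) : ht b ((w : Y ≃ₗ[ℤ] Y) y) < ht b y := by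
  have h1 := ht_le_len b ((w : Y ≃ₗ[ℤ] Y) y)
  rw [(ht_eq_len_iff b y).mpr hy, ← len_weyl b w y]
  refine lt_of_le_of_ne h1 fun h => hne ?_
  exact weyl_apply_eq_of_dominant b hy w.2 ((ht_eq_len_iff b _).mp h)

omit [Fintype ι] in
theorem smul_injective_of_rootDatum (P : RootDatum ι X Y) {d : ℤ} (hd : d ≠ 0) :
    Function.Injective fun y : Y => d • y := by
  have : Module.IsReflexive ℤ Y := .of_isPerfPair P.flip.toLinearMap
  exact smul_right_injective Y hd

end Height

end BasedRootDatum
end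

/-! ### Monic elements and unitriangular families -/

noncomputable section

namespace AddMonoidAlgebra

variable {R M : Type*} [CommRing R] [AddCommMonoid M]

theorem mul_mem_supported {s t u : Set M} (h : ∀ a ∈ s, ∀ b ∈ t, a + b ∈ u)
    {f g : AddMonoidAlgebra R M} (hf : f ∈ supported R R s) (hg : g ∈ supported R R t) :
    f * g ∈ supported R R u := by
  classical
  rw [mem_supported] at *
  intro c hc
  obtain ⟨a, ha, b, hb, rfl⟩ := Finset.mem_add.mp (support_coeff_mul_subset f g hc)
  exact h a (hf ha) b (hg hb)

omit [AddCommMonoid M] in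
theorem single_mem_supported {s : Set M} {a : M} (ha : a ∈ s) (r : R) :
    single a r ∈ supported R R s := by
  classical
  rw [mem_supported']
  intro m hm
  rw [coeff_single, Finsupp.single_apply, if_neg]
  rintro rfl
  exact hm ha

/-- `f` is `e^y` plus terms on which the weight function `h` is smaller than at `y`. -/
def IsMonicAt (h : M →+ ℤ) (f : AddMonoidAlgebra R M) (y : M) : Prop :=
  f - single y 1 ∈ supported R R {z | h z < h y}

variable {h : M →+ ℤ} {f g : AddMonoidAlgebra R M} {y z : M}

theorem isMonicAt_single (h : M →+ ℤ) (y : M) : IsMonicAt h (single y (1 : R)) y := by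
  simp [IsMonicAt]

theorem IsMonicAt.mem_supported (hf : IsMonicAt h f y) :
    f ∈ supported R R {z | h z ≤ h y} := by
  have h1 : f - single y 1 ∈ supported R R {z | h z ≤ h y} :=
    supported_mono (Set.ofPred_subset_ofPred.mpr fun z hz => le_of_lt hz) hf
  have h2 : single y 1 ∈ supported R R {z | h z ≤ h y} :=
    single_mem_supported (s := {z | h z ≤ h y}) (le_refl (h y)) 1
  simpa using Submodule.add_mem _ h1 h2

theorem IsMonicAt.mul (hf : IsMonicAt h f y) (hg : IsMonicAt h g z) :
    IsMonicAt h (f * g) (y + z) := by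
  have : f * g - single (y + z) 1 = (f - single y 1) * g + single y 1 * (g - single z 1) := by
    rw [sub_mul, mul_sub, single_mul_single, one_mul]
    ring
  rw [IsMonicAt, this]
  refine add_mem (mul_mem_supported ?_ hf hg.mem_supported)
    (mul_mem_supported ?_ (single_mem_supported (Set.mem_singleton y) 1) hg)
  · intro a ha c hc
    simp only [Set.mem_ofPred_eq, map_add] at *
    lia
  · rintro a rfl c hc
    simp only [Set.mem_ofPred_eq, map_add] at *
    lia

theorem IsMonicAt.pow (hf : IsMonicAt h f y) (n : ℕ) : IsMonicAt h (f ^ n) (n • y) := by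
  induction n with
  | zero => simpa [one_def] using isMonicAt_single (R := R) h 0
  | succ n ih =>
    rw [pow_succ, succ_nsmul]
    exact ih.mul hf

theorem IsMonicAt.prod {κ : Type*} (s : Finset κ) {f : κ → AddMonoidAlgebra R M} {y : κ → M}
    (hf : ∀ i ∈ s, IsMonicAt h (f i) (y i)) : IsMonicAt h (∏ i ∈ s, f i) (∑ i ∈ s, y i) := by
  classical
  induction s using Finset.induction_on with
  | empty => simpa [one_def] using isMonicAt_single (R := R) h 0
  | insert i s hi ih =>
    rw [Finset.prod_insert hi, Finset.sum_insert hi]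
    exact (hf i (Finset.mem_insert_self i s)).mul
      (ih fun j hj => hf j (Finset.mem_insert_of_mem hj))

theorem IsMonicAt.coeff_eq (hf : IsMonicAt h f y) (hz : h y ≤ h z) :
    f.coeff z = (single y (1 : R)).coeff z := by
  have := mem_supported'.mp hf z (by simpa using hz)
  simpa [sub_eq_zero] using this

theorem prod_single_one {κ : Type*} (s : Finset κ) (y : κ → M) :
    ∏ i ∈ s, single (y i) (1 : R) = single (∑ i ∈ s, y i) 1 := by
  classical
  induction s using Finset.induction_on with
  | empty => simp [one_def]
  | insert i s hi ih => rw [Finset.prod_insert hi, Finset.sum_insert hi, ih, single_mul_single,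
      one_mul]

end AddMonoidAlgebra

/-- A family that is unitriangular with respect to `h` for the coordinates `ξ` is a basis of every
submodule that contains it and whose elements are determined by these coordinates. -/
theorem Finsupp.linearCombination_injective_and_range_eq {R I V : Type*} [CommRing R]
    [AddCommGroup V] [Module R V] (ξ : V →ₗ[R] I →₀ R) (h : I → ℕ) (E : I → V)
    (htri : ∀ a c, h a ≤ h c → ξ (E a) c = Finsupp.single a 1 c)
    (N : Submodule R V) (hE : ∀ a, E a ∈ N) (hN : ∀ f ∈ N, ξ f = 0 → f = 0) :
    Function.Injective (Finsupp.linearCombination R E) ∧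
      LinearMap.range (Finsupp.linearCombination R E) = N := by
  classical
  have hle : LinearMap.range (Finsupp.linearCombination R E) ≤ N := by
    rw [Finsupp.range_linearCombination, Submodule.span_le]
    rintro _ ⟨a, rfl⟩
    exact hE a
  have hcoord : ∀ (c : I →₀ R) (m : I), (∀ a ∈ c.support, h a ≤ h m) →
      ξ (Finsupp.linearCombination R E c) m = c m := by
    intro c m hm
    rw [Finsupp.linearCombination_apply, Finsupp.sum, map_sum, Finsupp.finsetSum_apply]
    simp only [map_smul, Finsupp.smul_apply]
    rw [Finset.sum_congr rfl fun a ha => by rw [htri a m (hm a ha)]]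
    simp [Finsupp.single_apply, eq_comm]
  refine ⟨?_, le_antisymm hle ?_⟩
  · rw [← LinearMap.ker_eq_bot, LinearMap.ker_eq_bot']
    intro c hc
    by_contra hne
    obtain ⟨m, hm, hmax⟩ := c.support.exists_max_image h (Finsupp.support_nonempty_iff.mpr hne)
    have := hcoord c m hmax
    rw [hc, map_zero] at this
    exact Finsupp.mem_support_iff.mp hm this.symm
  -- Spanning: the top layer `h = n` of the coordinates of `f` is removed at once. This is possible
  -- because `htri` also covers ties, so members of one layer do not interfere.
  · have H : ∀ n : ℕ, ∀ f ∈ N, (∀ a, ξ f a ≠ 0 → h a < n) →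
        f ∈ LinearMap.range (Finsupp.linearCombination R E) := by
      intro n
      induction n with
      | zero =>
        intro f hf h0
        rw [hN f hf (Finsupp.ext fun a => by_contra fun ha => Nat.not_lt_zero _ (h0 a ha))]
        exact zero_mem _
      | succ n ih =>
        intro f hf hn
        let c : I →₀ R := (ξ f).filter fun a => h a = n
        have hc : ∀ a ∈ c.support, h a = n := fun a ha => by_contra fun hne =>
          Finsupp.mem_support_iff.mp ha (Finsupp.filter_apply_neg _ _ hne)
        have hg : Finsupp.linearCombination R E c ∈ LinearMap.range _ := ⟨c, rfl⟩
        have hsub := ih (f - Finsupp.linearCombination R E c) (sub_mem hf (hle hg)) (by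
          intro a ha
          by_contra hna
          rw [map_sub, Finsupp.sub_apply,
            hcoord c a fun m hm => (hc m hm).trans_le (not_lt.mp hna)] at ha
          by_cases han : h a = n
          · simp [c, han] at ha
          · have hfa : ξ f a ≠ 0 := by simpa [c, Finsupp.filter_apply, han] using ha
            have := hn a hfa
            lia)
        simpa using add_mem hsub hg
    intro f hf
    refine H ((ξ f).support.sup h + 1) f hf fun a ha => ?_
    exact Nat.lt_succ_of_le (Finset.le_sup (f := h) (Finsupp.mem_support_iff.mpr ha))

/-! ### The multiplicative family of invariants -/

namespace BasedRootDatum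

open AddMonoidAlgebra

variable {ι X Y : Type*} [AddCommGroup X] [AddCommGroup Y] {P : RootDatum ι X Y}
  [Fintype ι] (R : Type*) [CommRing R]

omit [Fintype ι] in
theorem coeff_weyl {f : AddMonoidAlgebra R Y} (hf : f ∈ latticeInvariants R P) (w : weyl P)
    (y : Y) : f.coeff ((w : Y ≃ₗ[ℤ] Y) y) = f.coeff y := by
  have := congrArg (fun g => g.coeff ((w : Y ≃ₗ[ℤ] Y) y)) (hf w)
  rw [← this]
  simp

/-- The endomorphism `e^y ↦ e^{d y}` of the group algebra. -/
def scale (Y : Type*) [AddCommGroup Y] (d : ℤ) : AddMonoidAlgebra R Y →ₐ[R] AddMonoidAlgebra R Y :=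
  mapDomainAlgHom R R (DistribSMul.toAddMonoidHom Y d)

@[simp] theorem scale_single (d : ℤ) (y : Y) (r : R) :
    scale R Y d (single y r) = single (d • y) r := by
  simp [scale]

omit [Fintype ι] in
theorem mem_latticeInvariants_of_scale {d : ℤ} (hd : d ≠ 0) {f : AddMonoidAlgebra R Y}
    (hf : scale R Y d f ∈ latticeInvariants R P) : f ∈ latticeInvariants R P := by
  intro w
  have hinj : Function.Injective (scale R Y d) :=
    mapDomain_injective (smul_injective_of_rootDatum P hd)
  apply hinj
  have hcomm : (scale R Y d).comp (domCongr R R (w : Y ≃ₗ[ℤ] Y).toAddEquiv).toAlgHom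
      = (domCongr R R (w : Y ≃ₗ[ℤ] Y).toAddEquiv).toAlgHom.comp (scale R Y d) := by
    ext y
    simp
  exact (DFunLike.congr_fun hcomm f).trans (hf w)

omit [Fintype ι] in
theorem sum_orbit_mem_latticeInvariants {y : Y} (hy : (MulAction.orbit (weyl P) y).Finite) :
    ∑ z ∈ hy.toFinset, single z (1 : R) ∈ latticeInvariants R P := by
  intro w
  rw [map_sum]
  refine Finset.sum_bij' (fun z _ => (w : Y ≃ₗ[ℤ] Y) z)
    (fun z _ => ((w⁻¹ : weyl P) : Y ≃ₗ[ℤ] Y) z) ?_ ?_ ?_ ?_ ?_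
  · intro z hz
    rw [Set.Finite.mem_toFinset] at hz ⊢
    exact MulAction.mem_orbit_of_mem_orbit w hz
  · intro z hz
    rw [Set.Finite.mem_toFinset] at hz ⊢
    exact MulAction.mem_orbit_of_mem_orbit w⁻¹ hz
  · intro z _
    exact (w : Y ≃ₗ[ℤ] Y).symm_apply_apply z
  · intro z _
    exact (w : Y ≃ₗ[ℤ] Y).apply_symm_apply z
  · intro z _
    simp

variable [P.IsReduced]

/-- The orbit of `η` consists of points `η + d q`, and `f` is the sum of the `e^q`; it plays the
role of `e^{-η/d}` times the orbit sum of `η/d`. -/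
theorem exists_isMonicAt_zero_scale_mul_mem (b : P.Base) {d : ℤ} (hd : 0 < d) {η : Y}
    (hη : η ∈ dominant b) (hdvd : ∀ j ∈ b.support, d ∣ P.toLinearMap (P.root j) η) :
    ∃ f : AddMonoidAlgebra R Y, IsMonicAt (ht b) f 0 ∧
      scale R Y d f * single η 1 ∈ latticeInvariants R P := by
  classical
  have hfin := finite_orbit b η
  have hq : ∀ z : Y, ∃ q : Y, z ∈ hfin.toFinset → z = η + d • q := by
    intro z
    by_cases hz : z ∈ hfin.toFinset
    · obtain ⟨w, rfl⟩ := hfin.mem_toFinset.mp hz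
      obtain ⟨q, hq⟩ := weyl_sub_mem_smul b hdvd w
      exact ⟨q, fun _ => hq⟩
    · exact ⟨0, fun h => absurd h hz⟩
  choose q hq using hq
  have hηmem : η ∈ hfin.toFinset := hfin.mem_toFinset.mpr (MulAction.mem_orbit_self η)
  have hq0 : q η = 0 := by
    have := hq η hηmem
    exact smul_injective_of_rootDatum P hd.ne' (by simpa using this)
  refine ⟨∑ z ∈ hfin.toFinset, single (q z) 1, ?_, ?_⟩
  · rw [IsMonicAt, ← Finset.add_sum_erase _ _ hηmem, hq0, add_sub_cancel_left]
    refine Submodule.sum_mem _ fun z hz => single_mem_supported ?_ 1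
    obtain ⟨hne, hz⟩ := Finset.mem_erase.mp hz
    have h1 := hq z hz
    obtain ⟨w, rfl⟩ := hfin.mem_toFinset.mp hz
    have h2 := ht_lt_of_mem_orbit b hη w hne
    have h3 := congrArg (ht b) h1
    rw [map_add, map_zsmul, smul_eq_mul] at h3
    change ht b ((w : Y ≃ₗ[ℤ] Y) η) = _ at h3
    rw [Set.mem_ofPred_eq, map_zero]
    rw [h3] at h2
    exact neg_of_mul_neg_right (by linarith) hd.le
  · convert sum_orbit_mem_latticeInvariants R hfin using 1
    rw [map_sum, Finset.sum_mul]
    refine Finset.sum_congr rfl fun z hz => ?_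
    rw [scale_single, single_mul_single, one_mul, add_comm, ← hq z hz]

theorem exists_dominant_family (b : P.Base) :
    ∃ M : Multiplicative (dominant b) →* AddMonoidAlgebra R Y, ∀ y : dominant b,
      IsMonicAt (ht b) (M (.ofAdd y)) y ∧ M (.ofAdd y) ∈ latticeInvariants R P := by
  classical
  obtain ⟨d, hd, η, hη⟩ := exists_scaled_fundamental_coweights b
  have hdom : ∀ i, η i ∈ dominant b := fun i => mem_dominant_of_support fun j hj => by
    rw [hη i ⟨j, hj⟩]
    split_ifs <;> lia
  have hdvd : ∀ i, ∀ j ∈ b.support, d ∣ P.toLinearMap (P.root j) (η i) := fun i j hj => by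
    rw [hη i ⟨j, hj⟩]
    split_ifs <;> simp
  choose f hf hinv using fun i => exists_isMonicAt_zero_scale_mul_mem R b hd (hdom i) (hdvd i)
  -- Truncation loses nothing on dominant coweights, so these exponents are additive there.
  let n : b.support → Y → ℕ := fun i y => (P.toLinearMap (P.root i) y).toNat
  have hn : ∀ i, ∀ y ∈ dominant b, (n i y : ℤ) = P.toLinearMap (P.root i) y := fun i y hy =>
    Int.toNat_of_nonneg (hy i (b.isPos_of_mem_support i.2))
  refine ⟨{ toFun := fun y => single (y.toAdd : Y) 1 * ∏ i, f i ^ n i y.toAdd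
            map_one' := by simp [n, one_def]
            map_mul' := ?_ }, fun y => ⟨?_, ?_⟩⟩
  · intro y z
    have hadd : ∀ i, n i ((y.toAdd : Y) + z.toAdd) = n i y.toAdd + n i z.toAdd := by
      intro i
      have h1 := hn i _ y.toAdd.2
      have h2 := hn i _ z.toAdd.2
      have h3 := hn i _ (add_mem y.toAdd.2 z.toAdd.2)
      rw [map_add] at h3
      lia
    simp only [toAdd_mul, AddSubmonoid.coe_add, hadd, pow_add, Finset.prod_mul_distrib]
    rw [← one_mul (1 : R), ← single_mul_single, one_mul]
    ring
  · have h1 := IsMonicAt.prod (h := ht b) Finset.univ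
      (fun i _ => (hf i).pow (n i y))
    have h2 := (isMonicAt_single (R := R) (ht b) (y : Y)).mul h1
    simpa using h2
  · apply mem_latticeInvariants_of_scale R hd.ne'
    -- After scaling, `M_y` is a product of orbit sums times `e^c` with `c = d y - ∑ n_i η_i`; this
    -- `c` is orthogonal to the simple roots, hence fixed by `W₀`.
    have hy0 : ∀ j ∈ b.support,
        P.toLinearMap (P.root j) (d • (y : Y) - ∑ i, n i y • η i) = 0 := by
      intro j hj
      rw [map_sub, map_sum, map_smul, Finset.sum_eq_single ⟨j, hj⟩]
      · rw [map_nsmul, hη ⟨j, hj⟩ ⟨j, hj⟩, if_pos rfl, nsmul_eq_mul, hn _ _ y.2, smul_eq_mul]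
        ring
      · intro i _ hi
        rw [map_nsmul, hη i ⟨j, hj⟩, if_neg hi, smul_zero]
      · simp
    have hkey : scale R Y d (single (y : Y) 1 * ∏ i, f i ^ n i y)
        = single (d • (y : Y) - ∑ i, n i y • η i) 1
          * ∏ i, (scale R Y d (f i) * single (η i) 1) ^ n i y := by
      simp only [mul_pow, Finset.prod_mul_distrib, single_pow, one_pow, prod_single_one, map_mul,
        map_prod, map_pow, scale_single]
      rw [mul_comm (∏ i, _) (single _ _), ← mul_assoc, single_mul_single, one_mul, sub_add_cancel]
    change scale R Y d (single (y : Y) 1 * ∏ i, f i ^ n i y) ∈ _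
    rw [hkey]
    refine mul_mem (fun w => ?_) (prod_mem fun i _ => pow_mem (hinv i) _)
    rw [domCongr_single]
    congr 1
    exact weyl_apply_eq_self b hy0 w

/-- By invariance `z` may be replaced by its dominant conjugate, where `ht` equals `ℓ`. -/
theorem len_le_of_isMonicAt (b : P.Base) {f : AddMonoidAlgebra R Y} {y : Y}
    (hf : IsMonicAt (ht b) f y) (hinv : f ∈ latticeInvariants R P) {z : Y} (hz : f.coeff z ≠ 0) :
    len b z ≤ len b y := by
  obtain ⟨w, hw⟩ := exists_weyl_apply_mem_dominant b z
  rw [← coeff_weyl R hinv w] at hz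
  have := mem_supported.mp hf.mem_supported (Finsupp.mem_support_iff.mpr hz)
  rw [Set.mem_ofPred_eq, (ht_eq_len_iff b _).mpr hw, len_weyl] at this
  exact this.trans (ht_le_len b y)

end BasedRootDatum
end

/-! ### The cone algebra as a Rees algebra -/

noncomputable section

namespace BasedRootDatum

open AddMonoidAlgebra

variable {ι X Y : Type*} [AddCommGroup X] [AddCommGroup Y] {P : RootDatum ι X Y}
  [Fintype ι] (R : Type*) [CommRing R]

section Rees

theorem nonneg_of_mem_cone {b : P.Base} (c : cone b) : 0 ≤ c.1.2 :=
  (len_nonneg b c.1.1).trans c.2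

/-- The map `e^{(y,k)} ↦ t^k e^y` from the cone algebra to `R[Y][t]`. -/
def coneToPoly (b : P.Base) :
    AddMonoidAlgebra R (cone b) →ₐ[R] Polynomial (AddMonoidAlgebra R Y) :=
  AddMonoidAlgebra.lift R (Polynomial (AddMonoidAlgebra R Y)) (cone b)
    { toFun := fun c => Polynomial.monomial c.toAdd.1.2.toNat (single c.toAdd.1.1 1)
      map_one' := by simp [← one_def]
      map_mul' := fun c d => by
        simp only [toAdd_mul, AddSubmonoid.coe_add, Prod.fst_add, Prod.snd_add]
        rw [Polynomial.monomial_mul_monomial, single_mul_single, one_mul,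
          Int.toNat_add (nonneg_of_mem_cone c.toAdd) (nonneg_of_mem_cone d.toAdd)] }

theorem coneToPoly_single (b : P.Base) (c : cone b) (r : R) :
    coneToPoly R b (single c r) = Polynomial.monomial c.1.2.toNat (single c.1.1 r) := by
  rw [coneToPoly, lift_single]
  change r • Polynomial.monomial _ _ = _
  rw [Polynomial.smul_monomial, smul_single, smul_eq_mul, mul_one]
  rfl

theorem coeff_coeff_coneToPoly (b : P.Base) (f : AddMonoidAlgebra R (cone b)) (c : cone b) :
    ((coneToPoly R b f).coeff c.1.2.toNat).coeff c.1.1 = f.coeff c := by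
  classical
  induction f using AddMonoidAlgebra.induction_linear with
  | zero => simp
  | add f g hf hg => simp [hf, hg]
  | single d r =>
    rw [coneToPoly_single, Polynomial.coeff_monomial]
    by_cases hdc : d = c
    · subst hdc
      simp
    · rw [coeff_single, Finsupp.single_apply, if_neg hdc]
      split_ifs with hk
      · rw [coeff_single, Finsupp.single_apply, if_neg]
        intro hy
        refine hdc (Subtype.ext (Prod.ext hy ?_))
        have h1 := nonneg_of_mem_cone c
        have h2 := nonneg_of_mem_cone d
        lia
      · rfl

theorem coneToPoly_injective (b : P.Base) : Function.Injective (coneToPoly R b) := by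
  intro f g h
  ext c
  rw [← coeff_coeff_coneToPoly, ← coeff_coeff_coneToPoly, h]

theorem coneToPoly_mem_rees (b : P.Base) (f : AddMonoidAlgebra R (cone b)) :
    coneToPoly R b f ∈ rees R b := by
  induction f using AddMonoidAlgebra.induction_linear with
  | zero => rw [map_zero]; exact zero_mem _
  | add f g hf hg => rw [map_add]; exact add_mem hf hg
  | single c r =>
    rw [coneToPoly_single]
    intro n
    rw [Polynomial.coeff_monomial]
    split_ifs with h
    · rw [show single c.1.1 r = r • single c.1.1 (1 : R) by simp]
      refine Submodule.smul_mem _ _ (Submodule.subset_span ⟨_, ?_, rfl⟩)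
      rw [← h, Int.toNat_of_nonneg (nonneg_of_mem_cone c)]
      exact c.2
    · exact zero_mem _

theorem exists_coneToPoly_eq (b : P.Base) {p : Polynomial (AddMonoidAlgebra R Y)}
    (hp : p ∈ rees R b) : ∃ f, coneToPoly R b f = p := by
  have hmon : ∀ n, lenFiltration R b n ≤ (LinearMap.range (coneToPoly R b).toLinearMap).comap
      ((Polynomial.monomial n).restrictScalars R) := by
    intro n
    rw [lenFiltration, Submodule.span_le]
    rintro _ ⟨y, hy, rfl⟩
    exact ⟨single ⟨(y, n), hy⟩ 1, by simp [coneToPoly_single]⟩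
  change p ∈ LinearMap.range (coneToPoly R b).toLinearMap
  rw [p.as_sum_support]
  exact Submodule.sum_mem _ fun n _ => hmon n (hp n)

/-- The cone algebra is the Rees algebra of the length filtration. -/
def coneEquivRees (b : P.Base) : AddMonoidAlgebra R (cone b) ≃ₐ[R] rees R b :=
  AlgEquiv.ofBijective ((coneToPoly R b).codRestrict (rees R b) (coneToPoly_mem_rees R b))
    ⟨fun _ _ h => coneToPoly_injective R b (congrArg Subtype.val h), fun p => by
      obtain ⟨f, hf⟩ := exists_coneToPoly_eq R b p.2
      exact ⟨f, Subtype.ext hf⟩⟩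

theorem coe_coneEquivRees (b : P.Base) (f : AddMonoidAlgebra R (cone b)) :
    (coneEquivRees R b f : Polynomial (AddMonoidAlgebra R Y)) = coneToPoly R b f := rfl

theorem eval_one_coneToPoly (b : P.Base) (f : AddMonoidAlgebra R (cone b)) :
    (coneToPoly R b f).eval 1 = coneAtOne R b f := by
  induction f using AddMonoidAlgebra.induction_linear with
  | zero => simp
  | add f g hf hg => simp [hf, hg]
  | single c r => simp [coneToPoly_single, coneAtOne]

end Rees

/-! ### Unitriangular bases of the two invariant algebras -/

theorem mem_lenFiltration (b : P.Base) {f : AddMonoidAlgebra R Y} {n : ℕ}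
    (hf : ∀ y, f.coeff y ≠ 0 → len b y ≤ n) : f ∈ lenFiltration R b n := by
  rw [← sum_coeff_single f]
  refine Submodule.sum_mem _ fun y hy => ?_
  rw [show single y (f.coeff y) = f.coeff y • single y (1 : R) by simp]
  exact Submodule.smul_mem _ _ (Submodule.subset_span ⟨y, hf y (by simpa using hy), rfl⟩)

instance (b : P.Base) : IsScalarTower R (Polynomial R) (AddMonoidAlgebra R (cone b)) :=
  IsScalarTower.of_algebraMap_eq fun r => by
    change _ = Polynomial.aeval _ (Polynomial.C r)
    rw [Polynomial.aeval_C]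

theorem mem_coneInvariants_iff (b : P.Base) {f : AddMonoidAlgebra R (cone b)} :
    f ∈ coneInvariants R b ↔ ∀ (w : weyl P) (c : cone b), f.coeff (coneAct b w c) = f.coeff c := by
  refine ⟨fun hf w c => ?_, fun hf w => ?_⟩
  · have := congrArg (fun g => g.coeff (coneAct b w c)) (hf w)
    rw [← this]
    simp
  · ext c
    rw [coeff_domCongr]
    have := hf w ((coneAct b w).symm c)
    rw [AddEquiv.apply_symm_apply] at this
    exact this.symm

theorem len_eq_toNat (b : P.Base) (y : Y) : ((len b y).toNat : ℤ) = len b y :=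
  Int.toNat_of_nonneg (len_nonneg b y)

variable [P.IsReduced]

omit [P.IsReduced] in
theorem coeff_dominant_of_isMonicAt {b : P.Base} {f : AddMonoidAlgebra R Y} {y z : dominant b}
    (hf : IsMonicAt (ht b) f y) (h : (len b (y : Y)).toNat ≤ (len b (z : Y)).toNat) :
    f.coeff z = Finsupp.single y 1 z := by
  classical
  have h' : ht b (y : Y) ≤ ht b (z : Y) := by
    rw [(ht_eq_len_iff b _).mpr y.2, (ht_eq_len_iff b _).mpr z.2, ← len_eq_toNat b (y : Y),
      ← len_eq_toNat b (z : Y)]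
    exact_mod_cast h
  rw [hf.coeff_eq h', coeff_single, Finsupp.single_apply, Finsupp.single_apply]
  simp only [Subtype.coe_inj]

/-- The coordinates are the coefficients at dominant coweights; they determine an invariant because
every orbit has a dominant point. -/
theorem dominant_family_bijective (b : P.Base)
    (M : Multiplicative (dominant b) →* AddMonoidAlgebra R Y)
    (hM : ∀ y : dominant b, IsMonicAt (ht b) (M (.ofAdd y)) y ∧
      M (.ofAdd y) ∈ latticeInvariants R P) :
    Function.Injective (AddMonoidAlgebra.lift R _ (dominant b) M) ∧
      (AddMonoidAlgebra.lift R _ (dominant b) M).range = latticeInvariants R P := by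
  let ξ : AddMonoidAlgebra R Y →ₗ[R] dominant b →₀ R :=
    (Finsupp.lcomapDomain Subtype.val Subtype.val_injective).comp
      (AddMonoidAlgebra.coeffLinearEquiv R).toLinearMap
  obtain ⟨hinj, hrange⟩ := Finsupp.linearCombination_injective_and_range_eq ξ
    (fun y => (len b (y : Y)).toNat) (fun y => M (.ofAdd y))
    (fun y z h => coeff_dominant_of_isMonicAt R (hM y).1 h)
    (Subalgebra.toSubmodule (latticeInvariants R P)) (fun y => (hM y).2) (fun f hf h0 => by
      ext z
      obtain ⟨w, hw⟩ := exists_weyl_apply_mem_dominant b z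
      rw [← coeff_weyl R hf w]
      exact DFunLike.congr_fun h0 ⟨_, hw⟩)
  have hlift : ∀ f, AddMonoidAlgebra.lift R _ (dominant b) M f =
      Finsupp.linearCombination R (fun y => M (.ofAdd y)) f.coeff := fun f => lift_apply M f
  constructor
  · intro f g h
    rw [hlift, hlift] at h
    exact AddMonoidAlgebra.coeff_injective (hinj h)
  · ext f
    rw [← Subalgebra.mem_toSubmodule (latticeInvariants R P), ← hrange]
    constructor
    · rintro ⟨g, rfl⟩
      exact ⟨g.coeff, (hlift g).symm⟩
    · rintro ⟨g, rfl⟩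
      exact ⟨.ofCoeff g, hlift _⟩

omit [P.IsReduced] in
/-- The lift `t^{ℓ(y)} M_y` to the cone algebra of a family `M_y` of elements of `R[Y]` with
`M_y` of length at most `ℓ(y)`. -/
theorem exists_cone_family (b : P.Base)
    (M : Multiplicative (dominant b) →* AddMonoidAlgebra R Y)
    (hM : ∀ (y : dominant b) (z : Y), (M (.ofAdd y)).coeff z ≠ 0 → len b z ≤ len b (y : Y)) :
    ∃ F : Multiplicative (dominant b) →* AddMonoidAlgebra R (cone b), ∀ y : dominant b,
      coneToPoly R b (F (.ofAdd y))
        = Polynomial.monomial (len b (y : Y)).toNat (M (.ofAdd y)) := by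
  have hmem : ∀ y : dominant b,
      Polynomial.monomial (len b (y : Y)).toNat (M (.ofAdd y)) ∈ rees R b := by
    intro y n
    rw [Polynomial.coeff_monomial]
    split_ifs with h
    · refine mem_lenFiltration R b fun z hz => ?_
      rw [← h, len_eq_toNat]
      exact hM y z hz
    · exact zero_mem _
  choose F hF using fun y : dominant b => exists_coneToPoly_eq R b (hmem y)
  refine ⟨⟨⟨fun y => F y.toAdd, ?_⟩, ?_⟩, hF⟩
  · apply coneToPoly_injective R b
    rw [toAdd_one, hF, map_one]
    simp [len_zero]
  · intro y z
    apply coneToPoly_injective R b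
    simp only [map_mul, hF, Polynomial.monomial_mul_monomial, toAdd_mul, AddSubmonoid.coe_add,
      ofAdd_add, ofAdd_toAdd]
    rw [len_add_of_dominant b y.toAdd.2 z.toAdd.2,
      Int.toNat_add (len_nonneg b _) (len_nonneg b _)]

/-- The element `(y, ℓ(y) + j)` of the cone. -/
def dominantCone (b : P.Base) (i : ℕ × dominant b) : cone b :=
  ⟨((i.2 : Y), len b (i.2 : Y) + i.1), by
    change len b (i.2 : Y) ≤ len b (i.2 : Y) + i.1
    lia⟩

omit [P.IsReduced] in
theorem dominantCone_injective (b : P.Base) : Function.Injective (dominantCone b) := by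
  rintro ⟨j, y⟩ ⟨k, z⟩ h
  have h1 := congrArg (fun c => c.1.1) h
  have h2 := congrArg (fun c => c.1.2) h
  simp only [dominantCone] at h1 h2
  obtain rfl := Subtype.ext h1
  simp at h2
  rw [h2]

omit [P.IsReduced] in
theorem coneToPoly_X_pow_smul (b : P.Base) (n : ℕ) (f : AddMonoidAlgebra R (cone b)) :
    coneToPoly R b ((Polynomial.X : Polynomial R) ^ n • f)
      = Polynomial.X ^ n * coneToPoly R b f := by
  have hX : algebraMap (Polynomial R) (AddMonoidAlgebra R (cone b)) Polynomial.X
      = single (coneUnit b) 1 := Polynomial.aeval_X _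
  rw [Algebra.smul_def, map_mul, map_pow, map_pow, hX, coneToPoly_single]
  simp [coneUnit, ← one_def, Polynomial.monomial_one_one_eq_X]

theorem cone_family_bijective (b : P.Base)
    (M : Multiplicative (dominant b) →* AddMonoidAlgebra R Y)
    (hM : ∀ y : dominant b, IsMonicAt (ht b) (M (.ofAdd y)) y ∧
      M (.ofAdd y) ∈ latticeInvariants R P)
    (F : Multiplicative (dominant b) →* AddMonoidAlgebra R (cone b))
    (hF : ∀ y : dominant b, coneToPoly R b (F (.ofAdd y))
        = Polynomial.monomial (len b (y : Y)).toNat (M (.ofAdd y))) :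
    Function.Injective (AddMonoidAlgebra.lift (Polynomial R) _ (dominant b) F) ∧
      (AddMonoidAlgebra.lift (Polynomial R) _ (dominant b) F).range = coneInvariants R b := by
  let ξ : AddMonoidAlgebra R (cone b) →ₗ[R] ℕ × dominant b →₀ R :=
    (Finsupp.lcomapDomain (dominantCone b) (dominantCone_injective b)).comp
      (AddMonoidAlgebra.coeffLinearEquiv R).toLinearMap
  have hξ : ∀ f i, ξ f i = f.coeff (dominantCone b i) := fun _ _ => rfl
  let E : ℕ × dominant b → AddMonoidAlgebra R (cone b) := fun i =>
    (Polynomial.X : Polynomial R) ^ i.1 • F (.ofAdd i.2)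
  have hE : ∀ i c, (E i).coeff c =
      if (i.1 : ℤ) + len b (i.2 : Y) = c.1.2 then (M (.ofAdd i.2)).coeff c.1.1 else 0 := by
    intro i c
    rw [← coeff_coeff_coneToPoly, coneToPoly_X_pow_smul, hF, Polynomial.X_pow_mul_monomial,
      Polynomial.coeff_monomial]
    have h1 := nonneg_of_mem_cone c
    have h2 := len_nonneg b (i.2 : Y)
    split_ifs
    · rfl
    · lia
    · lia
    · rfl
  obtain ⟨hinj, hrange⟩ := Finsupp.linearCombination_injective_and_range_eq ξ
    -- The weight ignores the power of `q`: for equal `y`, the degrees `ℓ(y) + j` already separate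
    -- the indices.
    (fun i => (len b (i.2 : Y)).toNat) E
    (by
      classical
      intro i k h
      rw [hξ, hE]
      simp only [dominantCone]
      rw [coeff_dominant_of_isMonicAt R (hM i.2).1 h, Finsupp.single_apply, Finsupp.single_apply]
      obtain ⟨j, y⟩ := i
      obtain ⟨j', y'⟩ := k
      by_cases hy : y = y'
      · subst hy
        simp [add_comm (len b (y : Y))]
      · simp [hy])
    ((Subalgebra.toSubmodule (coneInvariants R b)).restrictScalars R)
    (fun i => by
      change E i ∈ coneInvariants R b
      rw [mem_coneInvariants_iff]
      intro w c
      rw [hE, hE]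
      change (if _ = c.1.2 then (M (.ofAdd i.2)).coeff ((w : Y ≃ₗ[ℤ] Y) c.1.1) else 0) = _
      rw [coeff_weyl R (hM i.2).2])
    (fun f hf h0 => by
      ext c
      obtain ⟨w, hw⟩ := exists_weyl_apply_mem_dominant b c.1.1
      rw [← (mem_coneInvariants_iff R b).mp hf w]
      -- The excess `k - ℓ(y)` is constant on orbits and gives the exponent of `q`.
      have hc : coneAct b w c = dominantCone b ((c.1.2 - len b c.1.1).toNat, ⟨_, hw⟩) := by
        refine Subtype.ext (Prod.ext rfl ?_)
        have := c.2
        change len b c.1.1 ≤ c.1.2 at this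
        change c.1.2 = len b ((w : Y ≃ₗ[ℤ] Y) c.1.1) + ((c.1.2 - len b c.1.1).toNat : ℤ)
        rw [len_weyl]
        lia
      rw [hc]
      exact DFunLike.congr_fun h0 _)
  -- Over `R`, the `q^j e^y` form a basis of `R[q][Y⁺]`, and the lift of `F` sends them to the
  -- family `E`.
  let B := (Polynomial.basisMonomials R).smulTower
    (AddMonoidAlgebra.basis (dominant b) (Polynomial R))
  let Θ := AddMonoidAlgebra.lift (Polynomial R) (AddMonoidAlgebra R (cone b)) (dominant b) F
  have hΘ : ∀ p, Θ p = Finsupp.linearCombination R E (B.repr p) := by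
    have : Θ.toLinearMap.restrictScalars R
        = (Finsupp.linearCombination R E).comp B.repr.toLinearMap := by
      refine B.ext fun i => ?_
      rw [LinearMap.comp_apply, LinearEquiv.coe_coe, B.repr_self]
      simp [B, Θ, E, Module.Basis.smulTower_apply, Polynomial.monomial_one_right_eq_X_pow]
    exact fun p => LinearMap.congr_fun this p
  constructor
  · intro p p' h
    change Θ p = Θ p' at h
    rw [hΘ, hΘ] at h
    exact B.repr.injective (hinj h)
  · ext f
    change f ∈ Set.range Θ ↔
      f ∈ (Subalgebra.toSubmodule (coneInvariants R b)).restrictScalars R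
    rw [← hrange]
    constructor
    · rintro ⟨p, rfl⟩
      exact ⟨B.repr p, (hΘ p).symm⟩
    · rintro ⟨g, rfl⟩
      exact ⟨B.repr.symm g, by rw [hΘ, LinearEquiv.apply_symm_apply]⟩

/-- An injective algebra map gives an isomorphism from its range to its source. -/
def rangeEquiv {S A B : Type*} [CommRing S] [CommRing A] [CommRing B] [Algebra S A] [Algebra S B]
    (f : A →ₐ[S] B) (hf : Function.Injective f) {T : Subalgebra S B} (hT : f.range = T) :
    T ≃ₐ[S] A :=
  ((AlgEquiv.ofInjective f hf).trans (Subalgebra.equivOfEq _ _ hT)).symm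

theorem coe_rangeEquiv_symm {S A B : Type*} [CommRing S] [CommRing A] [CommRing B] [Algebra S A]
    [Algebra S B] (f : A →ₐ[S] B) (hf : Function.Injective f) {T : Subalgebra S B}
    (hT : f.range = T) (a : A) : ((rangeEquiv f hf hT).symm a : B) = f a := rfl

end BasedRootDatum
end

theorem theorem3p1 (R : Type*) [CommRing R] {ι X Y : Type*} [Fintype ι]
    [AddCommGroup X] [AddCommGroup Y] [Module.Finite ℤ X] [Module.Finite ℤ Y]
    (P : RootDatum ι X Y) [P.IsReduced] (b : P.Base) :
    -- the cone algebra is the Rees algebra of the length filtration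
    (∃ ρ : AddMonoidAlgebra R (BasedRootDatum.cone b) ≃ₐ[R] BasedRootDatum.rees R b,
      ∀ (y : Y) (k : ℕ) (h : (y, (k : ℤ)) ∈ BasedRootDatum.cone b),
        (ρ (AddMonoidAlgebra.single ⟨(y, (k : ℤ)), h⟩ 1) : Polynomial (AddMonoidAlgebra R Y)) =
          Polynomial.monomial k (AddMonoidAlgebra.single y 1)) ∧
    -- the main isomorphism, together with its specialization at `q = 1`
    ∃ φ : BasedRootDatum.coneInvariants R b ≃ₐ[Polynomial R]
        AddMonoidAlgebra (Polynomial R) (BasedRootDatum.dominant b),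
      ∃ ψ : BasedRootDatum.latticeInvariants R P ≃ₐ[R]
          AddMonoidAlgebra R (BasedRootDatum.dominant b),
        ∀ f : BasedRootDatum.coneInvariants R b,
          (ψ.symm (BasedRootDatum.dominantAtOne R b (φ f)) : AddMonoidAlgebra R Y) =
            BasedRootDatum.coneAtOne R b (f : AddMonoidAlgebra R (BasedRootDatum.cone b)) := by
  refine ⟨⟨BasedRootDatum.coneEquivRees R b, fun y k h => ?_⟩, ?_⟩
  · simp [BasedRootDatum.coe_coneEquivRees, BasedRootDatum.coneToPoly_single]
  obtain ⟨M, hM⟩ := BasedRootDatum.exists_dominant_family R b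
  obtain ⟨F, hF⟩ := BasedRootDatum.exists_cone_family R b M fun y z hz =>
    BasedRootDatum.len_le_of_isMonicAt R b (hM y).1 (hM y).2 hz
  obtain ⟨hinj, hrange⟩ := BasedRootDatum.dominant_family_bijective R b M hM
  obtain ⟨hinj', hrange'⟩ := BasedRootDatum.cone_family_bijective R b M hM F hF
  refine ⟨BasedRootDatum.rangeEquiv _ hinj' hrange', BasedRootDatum.rangeEquiv _ hinj hrange,
    fun f => ?_⟩
  -- Written through `p`, both sides are additive, and on `r q^n e^y` both equal `r M_y`, since
  -- `t^{n + ℓ(y)}` becomes `1` at `t = 1`.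
  obtain ⟨p, rfl⟩ := (BasedRootDatum.rangeEquiv _ hinj' hrange').symm.surjective f
  rw [AlgEquiv.apply_symm_apply, BasedRootDatum.coe_rangeEquiv_symm,
    BasedRootDatum.coe_rangeEquiv_symm]
  induction p using AddMonoidAlgebra.induction_linear with
  | zero => simp
  | add p p' hp hp' => simp only [map_add, hp, hp']
  | single y p =>
    induction p using Polynomial.induction_on' with
    | add p p' hp hp' => simp only [AddMonoidAlgebra.single_add, map_add, hp, hp']
    | monomial n r =>
      rw [← Polynomial.C_mul_X_pow_eq_monomial, AddMonoidAlgebra.lift_single, mul_smul,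
        ← BasedRootDatum.eval_one_coneToPoly, ← Polynomial.algebraMap_eq, algebraMap_smul, map_smul,
        BasedRootDatum.coneToPoly_X_pow_smul, hF]
      simp [BasedRootDatum.dominantAtOne]
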